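/- Let $n,m\ge 0$, $[n]=\{1,\dots,n\}$, $[n]_0=\{0,\dots,n\}$ and, for $A\subseteq[n]_0$, $A^+=A\setminus\{0\}$. A \emph{partial set supercomposition} of bidegree $(n,m)$, where $m\le n+1$, is a tuple $K=(K_1,\dots,K_q)$ of nonempty subsets of $[n]_0$ (blocks) such that $K_1^+\cup\dots\cup K_q^+=[n]$, $K_i\cap K_j\subseteq\{0\}$ for $i\ne j$, the blocks containing $0$ (the fermionic blocks) are exactly $K_1,\dots,K_m$, and $\min K_i<\min K_j$ for $m<i<j\le q$. Let $s\mathcal C_{n,m}$ be the set of these tuples. For $K,L\in s\mathcal C_{n,m}$ write $K\sqsubseteq L$ if, for each $i\in[m]$, $L_i$ is the union of $K_i$ and some (possibly no) nonfermionic blocks of $K$, and each nonfermionic block of $L$ is a union of nonfermionic blocks of $K$. This is a partial order on $s\mathcal C_{n,m}$, with meets $\sqcap$ and with least element $\hat 0=\hat0_{n,m}=(\{0\},\dots,\{0\},\{1\},\dots,\{n\})$; let $\mu$ be its Möbius function. A \emph{set superpartition} is a partial set supercomposition $I=(I_1,\dots,I_k)$ such that $I_i\neq I_j$ and $\min(I_i\setminus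 I_j)<\min(I_j\setminus I_i)$ for all $i<j$, where $\min\emptyset:=0$. Consider the $\mathbb Q$-algebra of formal power series of bounded degree in variables $x_1,x_2,\dots$ and $\theta_1,\theta_2,\dots$ subject to $x_i\theta_j=\theta_jx_i$ and $\theta_i\theta_j=-\theta_j\theta_i$ for all $i,j$. For $K\in s\mathcal C_{n,m}$ let $m_K$, $p_K$, $e_K$ be the sums of the words $\theta_{a_1}\cdots\theta_{a_m}x_{b_1}\cdots x_{b_n}$ over all tuples $(a_1,\dots,a_m,b_1,\dots,b_n)$ of positive integers such that, for all $i\in[m]$ and $j,k\in[n]$: \begin{itemize} \item for $m_K$: $a_i=b_j$ if and only if $j\in K_i$; and $b_j=b_k$ if and only if $j,k$ lie in the same block of $K$; \item for $p_K$: $a_i=b_j$ if $j\in K_i$; and $b_j=b_k$ if $j,k$ lie in the same block of $K$; \item for $e_K$: $a_i\ne b_j$ if $j\in K_i$; and $b_j\neq b_k$ if $j\ne k$ lie in the same block of $K$. \end{itemize} Let $h_K=\sum_u (K\sqcap L_u)!\,u$, summed over the words $u=\theta_{a_1}\cdots\theta_{a_m}x_{b_1}\cdots x_{b_n}$ with $a_1,\dots,a_m$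 distinct and at most one $a_i$ outside $\{b_1,\dots,b_n\}$, where $L_u\in s\mathcal C_{n,m}$ is the unique element such that $u$ is one of the words in the sum defining $m_{L_u}$, and $N!=\prod_i|N_i|!$ is the product of the factorials of the cardinalities of the blocks of $N$ (the element $0$ is counted). Then, for every set superpartition $I$ of bidegree $(n,m)$, \[m_I=\sum_{K\sqsupseteq I}\mu(I,K)\,p_K,\qquad m_I=\sum_{L\sqsupseteq I}\frac{\mu(I,L)}{\mu(\hat0,L)}\sum_{K\sqsubseteq L}\mu(K,L)\,e_K,\qquad m_I=\sum_{L\sqsupseteq I}\frac{\mu(I,L)}{|\mu(\hat0,L)|}\sum_{K\sqsubseteq L}\mu(K,L)\,h_K,\] where $K$ and $L$ range over $s\mathcal C_{n,m}$. -/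

import Mathlib

noncomputable section

namespace SuperNC

/-! ## Partial set supercompositions -/

/-- A partial set supercomposition `K = (K_1, …, K_q)` of bidegree `(n, m)`. Blocks are subsets of
`[n]_0 = {0, …, n}`, modelled by `Fin (n + 1)`. The first `m` entries of the tuple, the fermionic
blocks, are `ferm 0, …, ferm (m - 1)`; each contains `0`. The remaining entries do not contain `0`
and are ordered in the tuple by increasing minimum, so that this part of the tuple is the same thing
as the set `bos` of its entries. -/
@[ext]
structure PSC (n m : ℕ) where
  ferm : Fin m → Finset (Fin (n + 1))
  bos : Finset (Finset (Fin (n + 1)))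
  zero_mem_ferm : ∀ i, 0 ∈ ferm i
  zero_notMem_bos : ∀ B ∈ bos, 0 ∉ B
  bos_nonempty : ∀ B ∈ bos, B.Nonempty
  ferm_inter_ferm : ∀ i j, i ≠ j → ferm i ∩ ferm j ⊆ {0}
  ferm_disjoint_bos : ∀ i, ∀ B ∈ bos, Disjoint (ferm i) B
  bos_disjoint_bos : ∀ B ∈ bos, ∀ C ∈ bos, B ≠ C → Disjoint B C
  cover : ∀ j : Fin n, (∃ i, j.succ ∈ ferm i) ∨ ∃ B ∈ bos, j.succ ∈ B

namespace PSC

variable {n m : ℕ}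

instance : Finite (PSC n m) :=
  Finite.of_injective
    (fun K : PSC n m => ((K.ferm, K.bos) :
      (Fin m → Finset (Fin (n + 1))) × Finset (Finset (Fin (n + 1)))))
    (fun _ _ h => PSC.ext (congrArg Prod.fst h) (congrArg Prod.snd h))

instance : Fintype (PSC n m) := Fintype.ofFinite _

instance : DecidableEq (PSC n m) := Classical.decEq _

/-- The positions `j` and `k` of `[n]` lie in the same block of `K`. -/
def SameBlock (K : PSC n m) (j k : Fin n) : Prop :=
  (∃ i, j.succ ∈ K.ferm i ∧ k.succ ∈ K.ferm i) ∨ ∃ B ∈ K.bos, j.succ ∈ B ∧ k.succ ∈ B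

/-- `K ⊑ L`: the `i`th fermionic block of `L` is the `i`th fermionic block of `K` joined with some
(possibly no) nonfermionic blocks of `K`, and each nonfermionic block of `L` is a union of
nonfermionic blocks of `K`. -/
instance : LE (PSC n m) where
  le K L :=
    (∀ i, ∃ S : Finset (Finset (Fin (n + 1))), S ⊆ K.bos ∧ L.ferm i = K.ferm i ∪ S.sup id) ∧
    (∀ B ∈ L.bos, ∃ S : Finset (Finset (Fin (n + 1))), S ⊆ K.bos ∧ B = S.sup id)

lemma le_def (K L : PSC n m) : K ≤ L ↔
    (∀ i, ∃ S : Finset (Finset (Fin (n + 1))), S ⊆ K.bos ∧ L.ferm i = K.ferm i ∪ S.sup id) ∧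
    (∀ B ∈ L.bos, ∃ S : Finset (Finset (Fin (n + 1))), S ⊆ K.bos ∧ B = S.sup id) := Iff.rfl

lemma ferm_eq_of_mem (K : PSC n m) {i i' : Fin m} {j : Fin n}
    (h : j.succ ∈ K.ferm i) (h' : j.succ ∈ K.ferm i') : i = i' := by
  by_contra hne
  have := K.ferm_inter_ferm i i' hne (Finset.mem_inter.2 ⟨h, h'⟩)
  exact Fin.succ_ne_zero j (Finset.mem_singleton.1 this)

lemma bos_eq_of_mem (K : PSC n m) {B C : Finset (Fin (n + 1))} (hB : B ∈ K.bos) (hC : C ∈ K.bos)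
    {j : Fin (n + 1)} (h : j ∈ B) (h' : j ∈ C) : B = C := by
  by_contra hne
  exact Finset.disjoint_left.1 (K.bos_disjoint_bos B hB C hC hne) h h'

lemma notMem_bos_of_mem_ferm (K : PSC n m) {i : Fin m} {B : Finset (Fin (n + 1))} (hB : B ∈ K.bos)
    {j : Fin (n + 1)} (h : j ∈ K.ferm i) : j ∉ B :=
  Finset.disjoint_left.1 (K.ferm_disjoint_bos i B hB) h

lemma SameBlock.mem_ferm {K : PSC n m} {j k : Fin n} (h : K.SameBlock j k) {i : Fin m}
    (hj : j.succ ∈ K.ferm i) : k.succ ∈ K.ferm i := by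
  rcases h with ⟨i', h1, h2⟩ | ⟨B, hB, h1, h2⟩
  · rwa [K.ferm_eq_of_mem hj h1]
  · exact absurd h1 (K.notMem_bos_of_mem_ferm hB hj)

lemma SameBlock.mem_bos {K : PSC n m} {j k : Fin n} (h : K.SameBlock j k)
    {B : Finset (Fin (n + 1))} (hB : B ∈ K.bos) (hj : j.succ ∈ B) : k.succ ∈ B := by
  rcases h with ⟨i', h1, h2⟩ | ⟨C, hC, h1, h2⟩
  · exact absurd hj (K.notMem_bos_of_mem_ferm hB h1)
  · rwa [K.bos_eq_of_mem hB hC hj h1]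

lemma SameBlock.refl (K : PSC n m) (j : Fin n) : K.SameBlock j j := by
  rcases K.cover j with ⟨i, h⟩ | ⟨B, hB, h⟩
  · exact Or.inl ⟨i, h, h⟩
  · exact Or.inr ⟨B, hB, h, h⟩

lemma SameBlock.symm {K : PSC n m} {j k : Fin n} (h : K.SameBlock j k) : K.SameBlock k j := by
  rcases h with ⟨i', h1, h2⟩ | ⟨C, hC, h1, h2⟩
  · exact Or.inl ⟨i', h2, h1⟩
  · exact Or.inr ⟨C, hC, h2, h1⟩

lemma SameBlock.trans {K : PSC n m} {j k l : Fin n} (h : K.SameBlock j k) (h' : K.SameBlock k l) :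
    K.SameBlock j l := by
  rcases h with ⟨i', h1, h2⟩ | ⟨C, hC, h1, h2⟩
  · exact Or.inl ⟨i', h1, h'.mem_ferm h2⟩
  · exact Or.inr ⟨C, hC, h1, h'.mem_bos hC h2⟩

/-- Two partial set supercompositions with the same incidences are equal. -/
lemma ext_of_mem {K L : PSC n m} (hf : ∀ i (j : Fin n), j.succ ∈ K.ferm i ↔ j.succ ∈ L.ferm i)
    (hs : ∀ j k, K.SameBlock j k ↔ L.SameBlock j k) : K = L := by
  have key : ∀ {K L : PSC n m}, (∀ i (j : Fin n), j.succ ∈ K.ferm i ↔ j.succ ∈ L.ferm i) →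
      (∀ j k, K.SameBlock j k ↔ L.SameBlock j k) → K.bos ⊆ L.bos := by
    intro K L hf hs B hB
    obtain ⟨x, hx⟩ := K.bos_nonempty B hB
    have hx0 : x ≠ 0 := fun h => K.zero_notMem_bos B hB (h ▸ hx)
    obtain ⟨j, rfl⟩ := Fin.exists_succ_eq.2 hx0
    rcases L.cover j with ⟨i, hi⟩ | ⟨C, hC, hj⟩
    · exact absurd hx (K.notMem_bos_of_mem_ferm hB ((hf i j).2 hi))
    · have : B = C := by
        ext y
        refine Fin.cases ?_ (fun k => ?_) y
        · exact iff_of_false (K.zero_notMem_bos B hB) (L.zero_notMem_bos C hC)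
        · constructor
          · intro hk
            exact ((hs j k).1 (Or.inr ⟨B, hB, hx, hk⟩)).mem_bos hC hj
          · intro hk
            exact ((hs j k).2 (Or.inr ⟨C, hC, hj, hk⟩)).mem_bos hB hx
      rwa [this]
  refine PSC.ext (funext fun i => ?_)
    (Finset.Subset.antisymm (key hf hs)
      (key (fun i j => (hf i j).symm) (fun j k => (hs j k).symm)))
  ext y
  refine Fin.cases ?_ (fun k => hf i k) y
  exact iff_of_true (K.zero_mem_ferm i) (L.zero_mem_ferm i)

/-- Strong refinement in terms of incidences. -/
lemma le_iff (K L : PSC n m) : K ≤ L ↔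
    (∀ i (j : Fin n), j.succ ∈ K.ferm i → j.succ ∈ L.ferm i) ∧
    (∀ j k, K.SameBlock j k → L.SameBlock j k) := by
  classical
  constructor
  · rintro ⟨h1, h2⟩
    have hsub : ∀ i (j : Fin n), j.succ ∈ K.ferm i → j.succ ∈ L.ferm i := by
      intro i j hj
      obtain ⟨S, _, hS⟩ := h1 i
      rw [hS]
      exact Finset.mem_union_left _ hj
    refine ⟨hsub, ?_⟩
    rintro j k (⟨i, hj, hk⟩ | ⟨B, hB, hj, hk⟩)
    · exact Or.inl ⟨i, hsub i j hj, hsub i k hk⟩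
    · rcases L.cover j with ⟨i, hi⟩ | ⟨C, hC, hjC⟩
      · obtain ⟨S, hSK, hS⟩ := h1 i
        have hi' := hi
        rw [hS, Finset.mem_union, Finset.mem_sup] at hi'
        rcases hi' with h | ⟨D, hD, hjD⟩
        · exact absurd hj (K.notMem_bos_of_mem_ferm hB h)
        · have : B = D := K.bos_eq_of_mem hB (hSK hD) hj hjD
          refine Or.inl ⟨i, hi, ?_⟩
          rw [hS, Finset.mem_union, Finset.mem_sup]
          exact Or.inr ⟨D, hD, this ▸ hk⟩
      · obtain ⟨S, hSK, hS⟩ := h2 C hC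
        have hjC' := hjC
        rw [hS, Finset.mem_sup] at hjC'
        obtain ⟨D, hD, hjD⟩ := hjC'
        have : B = D := K.bos_eq_of_mem hB (hSK hD) hj hjD
        refine Or.inr ⟨C, hC, hjC, ?_⟩
        rw [hS, Finset.mem_sup]
        exact ⟨D, hD, this ▸ hk⟩
  · rintro ⟨h1, h2⟩
    constructor
    · intro i
      refine ⟨K.bos.filter (· ⊆ L.ferm i), Finset.filter_subset _ _, ?_⟩
      ext y
      rw [Finset.mem_union, Finset.mem_sup]
      refine Fin.cases ?_ (fun k => ?_) y
      · exact iff_of_true (L.zero_mem_ferm i) (Or.inl (K.zero_mem_ferm i))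
      · constructor
        · intro hk
          rcases K.cover k with ⟨i', hi'⟩ | ⟨B, hB, hkB⟩
          · left
            rwa [L.ferm_eq_of_mem hk (h1 _ _ hi')]
          · refine Or.inr ⟨B, Finset.mem_filter.2 ⟨hB, ?_⟩, hkB⟩
            intro z
            refine Fin.cases (fun hz => absurd hz (K.zero_notMem_bos B hB)) (fun l hl => ?_) z
            exact (h2 k l (Or.inr ⟨B, hB, hkB, hl⟩)).mem_ferm hk
        · rintro (hk | ⟨B, hB, hkB⟩)
          · exact h1 _ _ hk
          · exact (Finset.mem_filter.1 hB).2 hkB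
    · intro C hC
      refine ⟨K.bos.filter (· ⊆ C), Finset.filter_subset _ _, ?_⟩
      ext y
      rw [Finset.mem_sup]
      refine Fin.cases ?_ (fun k => ?_) y
      · refine iff_of_false (L.zero_notMem_bos C hC) ?_
        rintro ⟨B, hB, h0⟩
        exact K.zero_notMem_bos B (Finset.mem_filter.1 hB).1 h0
      · constructor
        · intro hk
          rcases K.cover k with ⟨i', hi'⟩ | ⟨B, hB, hkB⟩
          · exact absurd hk (L.notMem_bos_of_mem_ferm hC (h1 _ _ hi'))
          · refine ⟨B, Finset.mem_filter.2 ⟨hB, ?_⟩, hkB⟩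
            intro z
            refine Fin.cases (fun hz => absurd hz (K.zero_notMem_bos B hB)) (fun l hl => ?_) z
            exact (h2 k l (Or.inr ⟨B, hB, hkB, hl⟩)).mem_bos hC hk
        · rintro ⟨B, hB, hkB⟩
          exact (Finset.mem_filter.1 hB).2 hkB

/-- The strong coarsening order. -/
instance : PartialOrder (PSC n m) where
  le_refl K := (le_iff K K).2 ⟨fun _ _ h => h, fun _ _ h => h⟩
  le_trans K L N h h' := by
    rw [le_iff] at h h' ⊢
    exact ⟨fun i j hj => h'.1 i j (h.1 i j hj), fun j k hj => h'.2 j k (h.2 j k hj)⟩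
  le_antisymm K L h h' := by
    rw [le_iff] at h h'
    exact ext_of_mem (fun i j => ⟨h.1 i j, h'.1 i j⟩) (fun j k => ⟨h.2 j k, h'.2 j k⟩)

/-- The partial set supercomposition with prescribed incidences: `f i j` says that `j` lies in the
`i`th fermionic block and `r j k` says that `j` and `k` lie in the same block. -/
def ofRel (f : Fin m → Fin n → Prop) (r : Fin n → Fin n → Prop) (hr : Equivalence r)
    (hf : ∀ i i' j, f i j → f i' j → i = i') (hfr : ∀ i j k, r j k → f i j → f i k) : PSC n m := by
  classical
  exact
  { ferm := fun i => insert 0 ((Finset.univ.filter (f i)).image Fin.succ)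
    bos := (Finset.univ.filter fun j => ∀ i, ¬ f i j).image
      fun j => (Finset.univ.filter (r j)).image Fin.succ
    zero_mem_ferm := fun i => Finset.mem_insert_self _ _
    zero_notMem_bos := by
      intro B hB h0
      simp only [Finset.mem_image, Finset.mem_filter, Finset.mem_univ, true_and] at hB
      obtain ⟨j, _, rfl⟩ := hB
      simp [Fin.succ_ne_zero] at h0
    bos_nonempty := by
      intro B hB
      simp only [Finset.mem_image, Finset.mem_filter, Finset.mem_univ, true_and] at hB
      obtain ⟨j, _, rfl⟩ := hB
      exact ⟨j.succ, by simpa using hr.refl j⟩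
    ferm_inter_ferm := by
      intro i i' hne y
      refine Fin.cases (fun _ => by simp) (fun j hj => ?_) y
      simp [Fin.succ_ne_zero] at hj
      exact absurd (hf _ _ _ hj.1 hj.2) hne
    ferm_disjoint_bos := by
      intro i B hB
      simp only [Finset.mem_image, Finset.mem_filter, Finset.mem_univ, true_and] at hB
      obtain ⟨j, hj, rfl⟩ := hB
      rw [Finset.disjoint_left]
      intro y
      refine Fin.cases (fun _ => by simp [Fin.succ_ne_zero]) (fun k hk hk' => ?_) y
      simp [Fin.succ_ne_zero] at hk hk'
      exact hj i (hfr i k j (hr.symm hk') hk)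
    bos_disjoint_bos := by
      intro B hB C hC hne
      simp only [Finset.mem_image, Finset.mem_filter, Finset.mem_univ, true_and] at hB hC
      obtain ⟨j, hj, rfl⟩ := hB
      obtain ⟨k, hk, rfl⟩ := hC
      rw [Finset.disjoint_left]
      intro y
      refine Fin.cases (fun h => by simp [Fin.succ_ne_zero] at h) (fun l h1 h2 => hne ?_) y
      simp at h1 h2
      have hjk : r j k := hr.trans h1 (hr.symm h2)
      congr 1
      ext z
      simp only [Finset.mem_filter, Finset.mem_univ, true_and]
      exact ⟨fun h => hr.trans (hr.symm hjk) h, fun h => hr.trans hjk h⟩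
    cover := by
      intro j
      by_cases h : ∃ i, f i j
      · obtain ⟨i, hi⟩ := h
        exact Or.inl ⟨i, by simpa [Fin.succ_ne_zero] using hi⟩
      · push Not at h
        refine Or.inr ⟨(Finset.univ.filter (r j)).image Fin.succ, ?_, ?_⟩
        · exact Finset.mem_image.2 ⟨j, by simpa using h, rfl⟩
        · simpa using hr.refl j }

lemma mem_ferm_ofRel {f : Fin m → Fin n → Prop} {r : Fin n → Fin n → Prop} {hr : Equivalence r}
    {hf : ∀ i i' j, f i j → f i' j → i = i'} {hfr : ∀ i j k, r j k → f i j → f i k}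
    (i : Fin m) (j : Fin n) : j.succ ∈ (ofRel f r hr hf hfr).ferm i ↔ f i j := by
  simp [ofRel, Fin.succ_ne_zero]

/-- If the elements of every fermionic block are related, `r` is the relation of lying in the same
block of `ofRel f r`. -/
lemma sameBlock_ofRel {f : Fin m → Fin n → Prop} {r : Fin n → Fin n → Prop} {hr : Equivalence r}
    {hf : ∀ i i' j, f i j → f i' j → i = i'} {hfr : ∀ i j k, r j k → f i j → f i k}
    (h : ∀ i j k, f i j → f i k → r j k) (j k : Fin n) :
    (ofRel f r hr hf hfr).SameBlock j k ↔ r j k := by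
  constructor
  · rintro (⟨i, h1, h2⟩ | ⟨B, hB, h1, h2⟩)
    · rw [mem_ferm_ofRel] at h1 h2
      exact h i j k h1 h2
    · simp only [ofRel, Finset.mem_image, Finset.mem_filter, Finset.mem_univ, true_and] at hB
      obtain ⟨l, _, rfl⟩ := hB
      simp at h1 h2
      exact hr.trans (hr.symm h1) h2
  · intro hjk
    rcases (ofRel f r hr hf hfr).cover j with ⟨i, hi⟩ | ⟨B, hB, hj⟩
    · refine Or.inl ⟨i, hi, ?_⟩
      rw [mem_ferm_ofRel] at hi ⊢
      exact hfr i j k hjk hi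
    · refine Or.inr ⟨B, hB, hj, ?_⟩
      simp only [ofRel, Finset.mem_image, Finset.mem_filter, Finset.mem_univ, true_and] at hB
      obtain ⟨l, _, rfl⟩ := hB
      simp at hj ⊢
      exact hr.trans hj hjk

/-- The meet `K ⊓ L`. Its fermionic blocks are `K_i ∩ L_i`, and outside of these `j` and `k` lie in
the same block if they do so both in `K` and in `L`. -/
def meet (K L : PSC n m) : PSC n m :=
  ofRel (fun i j => j.succ ∈ K.ferm i ∧ j.succ ∈ L.ferm i)
    (fun j k => K.SameBlock j k ∧ L.SameBlock j k)
    ⟨fun j => ⟨.refl K j, .refl L j⟩, fun h => ⟨h.1.symm, h.2.symm⟩,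
      fun h h' => ⟨h.1.trans h'.1, h.2.trans h'.2⟩⟩
    (fun _ _ _ h h' => K.ferm_eq_of_mem h.1 h'.1)
    (fun _ _ _ h h' => ⟨h.1.mem_ferm h'.1, h.2.mem_ferm h'.2⟩)

lemma mem_ferm_meet (K L : PSC n m) (i : Fin m) (j : Fin n) :
    j.succ ∈ (meet K L).ferm i ↔ j.succ ∈ K.ferm i ∧ j.succ ∈ L.ferm i := mem_ferm_ofRel i j

lemma sameBlock_meet (K L : PSC n m) (j k : Fin n) :
    (meet K L).SameBlock j k ↔ K.SameBlock j k ∧ L.SameBlock j k :=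
  sameBlock_ofRel (fun i _ _ h h' => ⟨Or.inl ⟨i, h.1, h'.1⟩, Or.inl ⟨i, h.2, h'.2⟩⟩) j k

instance : SemilatticeInf (PSC n m) where
  inf := meet
  inf_le_left K L := (le_iff _ _).2
    ⟨fun i j h => ((mem_ferm_meet K L i j).1 h).1, fun j k h => ((sameBlock_meet K L j k).1 h).1⟩
  inf_le_right K L := (le_iff _ _).2
    ⟨fun i j h => ((mem_ferm_meet K L i j).1 h).2, fun j k h => ((sameBlock_meet K L j k).1 h).2⟩
  le_inf N K L h h' := by
    rw [le_iff] at h h' ⊢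
    exact ⟨fun i j hj => (mem_ferm_meet K L i j).2 ⟨h.1 i j hj, h'.1 i j hj⟩,
      fun j k hj => (sameBlock_meet K L j k).2 ⟨h.2 j k hj, h'.2 j k hj⟩⟩

/-- The least element `0̂ = ({0}, …, {0}, {1}, …, {n})`. -/
instance : OrderBot (PSC n m) where
  bot :=
    { ferm := fun _ => {0}
      bos := Finset.univ.image fun j : Fin n => ({j.succ} : Finset (Fin (n + 1)))
      zero_mem_ferm := by simp
      zero_notMem_bos := by
        intro B hB
        obtain ⟨j, _, rfl⟩ := Finset.mem_image.1 hB
        simpa using (Fin.succ_ne_zero j).symm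
      bos_nonempty := by
        intro B hB
        obtain ⟨j, _, rfl⟩ := Finset.mem_image.1 hB
        simp
      ferm_inter_ferm := by simp
      ferm_disjoint_bos := by
        intro i B hB
        obtain ⟨j, _, rfl⟩ := Finset.mem_image.1 hB
        simpa using (Fin.succ_ne_zero j).symm
      bos_disjoint_bos := by
        intro B hB C hC hne
        obtain ⟨j, _, rfl⟩ := Finset.mem_image.1 hB
        obtain ⟨k, _, rfl⟩ := Finset.mem_image.1 hC
        simpa using hne
      cover := fun j => Or.inr ⟨{j.succ}, Finset.mem_image_of_mem _ (Finset.mem_univ j), by simp⟩ }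
  bot_le K := by
    rw [le_iff]
    refine ⟨fun i j h => absurd (Finset.mem_singleton.1 h) (Fin.succ_ne_zero j), ?_⟩
    rintro j k (⟨i, h, _⟩ | ⟨B, hB, h1, h2⟩)
    · exact absurd (Finset.mem_singleton.1 h) (Fin.succ_ne_zero j)
    · obtain ⟨l, _, rfl⟩ := Finset.mem_image.1 hB
      have hj := Fin.succ_injective _ (Finset.mem_singleton.1 h1)
      have hk := Fin.succ_injective _ (Finset.mem_singleton.1 h2)
      rw [hj, hk]
      exact .refl K l

open Classical in
instance : LocallyFiniteOrder (PSC n m) := Fintype.toLocallyFiniteOrder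

/-- The minimum of a set of indices, with the convention `min ∅ = 0`. -/
def minOrZero (S : Finset (Fin (n + 1))) : Fin (n + 1) :=
  if h : S.Nonempty then S.min' h else 0

/-- `I` is a set superpartition: `I_i ≠ I_j` and `min (I_i \ I_j) < min (I_j \ I_i)` for all `i < j`,
with `min ∅ = 0`. Only pairs of fermionic blocks have to be compared: for the other pairs the
condition holds by the ordering of the tuple. -/
def IsSetSuperpartition (I : PSC n m) : Prop :=
  ∀ i j, i < j →
    I.ferm i ≠ I.ferm j ∧ minOrZero (I.ferm i \ I.ferm j) < minOrZero (I.ferm j \ I.ferm i)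

/-- `K! = |K_1|! ⋯ |K_q|!`, the number of ways to sort the elements of all the blocks of `K`
simultaneously; the element `0` of a fermionic block counts as an element. -/
def blockFactorial (K : PSC n m) : ℕ :=
  (∏ i, (K.ferm i).card.factorial) * ∏ B ∈ K.bos, B.card.factorial

/-- Membership of the word `θ_{a_1} ⋯ θ_{a_m} x_{b_1} ⋯ x_{b_n}` in `M(K)`. -/
def IsM (K : PSC n m) (a : Fin m → ℕ) (b : Fin n → ℕ) : Prop :=
  (∀ i j, a i = b j ↔ j.succ ∈ K.ferm i) ∧ ∀ j k, b j = b k ↔ K.SameBlock j k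

/-- Membership of the word `θ_{a_1} ⋯ θ_{a_m} x_{b_1} ⋯ x_{b_n}` in `P(K)`. -/
def IsP (K : PSC n m) (a : Fin m → ℕ) (b : Fin n → ℕ) : Prop :=
  (∀ i (j : Fin n), j.succ ∈ K.ferm i → a i = b j) ∧ ∀ j k, K.SameBlock j k → b j = b k

/-- Membership of the word `θ_{a_1} ⋯ θ_{a_m} x_{b_1} ⋯ x_{b_n}` in `E(K)`. -/
def IsE (K : PSC n m) (a : Fin m → ℕ) (b : Fin n → ℕ) : Prop :=
  (∀ i (j : Fin n), j.succ ∈ K.ferm i → a i ≠ b j) ∧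
    ∀ j k, j ≠ k → K.SameBlock j k → b j ≠ b k

/-- The word `θ_{a_1} ⋯ θ_{a_m} x_{b_1} ⋯ x_{b_n}` is a (nonzero) monomial that is not
null-symmetric: the `a_i` are distinct, and at most one of them is not among the `b_j`. -/
def NonNullSymmetric (a : Fin m → ℕ) (b : Fin n → ℕ) : Prop :=
  Function.Injective a ∧ (Set.range a \ Set.range b).Subsingleton

lemma IsM.unique {K L : PSC n m} {a : Fin m → ℕ} {b : Fin n → ℕ} (hK : K.IsM a b)
    (hL : L.IsM a b) : K = L :=
  ext_of_mem (fun i j => (hK.1 i j).symm.trans (hL.1 i j))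
    (fun j k => (hK.2 j k).symm.trans (hL.2 j k))

lemma existsUnique_isM {a : Fin m → ℕ} {b : Fin n → ℕ} (h : NonNullSymmetric a b) :
    ∃! L : PSC n m, L.IsM a b := by
  have hM : (ofRel (fun i j => a i = b j) (fun j k => b j = b k)
      ⟨fun _ => rfl, fun h => h.symm, fun h h' => h.trans h'⟩
      (fun _ _ _ h1 h2 => h.1 (h1.trans h2.symm)) (fun _ _ _ h1 h2 => h2.trans h1)
      : PSC n m).IsM a b :=
    ⟨fun i j => (mem_ferm_ofRel (f := fun i j => a i = b j) i j).symm,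
      fun j k => (sameBlock_ofRel (f := fun i j => a i = b j) (r := fun j k => b j = b k)
        (fun _ _ _ h1 h2 => h1.symm.trans h2) j k).symm⟩
  exact ⟨_, hM, fun L hL => hL.unique hM⟩

/-- The unique `L` such that the given monomial belongs to `M(L)`. -/
def shape {a : Fin m → ℕ} {b : Fin n → ℕ} (h : NonNullSymmetric a b) : PSC n m :=
  (existsUnique_isM h).choose

lemma shape_spec {a : Fin m → ℕ} {b : Fin n → ℕ} (h : NonNullSymmetric a b) :
    (shape h).IsM a b := (existsUnique_isM h).choose_spec.1

end PSC

/-! ## Functions in superspace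

The variables `x_i` and `θ_i` are indexed by `i : ℕ`. -/

/-- The relations `x_i θ_j = θ_j x_i` and `θ_i θ_j = - θ_j θ_i`; the generators `Sum.inl i` and
`Sum.inr i` stand for `x_i` and `θ_i`. -/
inductive SuperRel : FreeAlgebra ℚ (ℕ ⊕ ℕ) → FreeAlgebra ℚ (ℕ ⊕ ℕ) → Prop
  | comm (i j : ℕ) : SuperRel
      (FreeAlgebra.ι ℚ (Sum.inl i) * FreeAlgebra.ι ℚ (Sum.inr j))
      (FreeAlgebra.ι ℚ (Sum.inr j) * FreeAlgebra.ι ℚ (Sum.inl i))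
  | anticomm (i j : ℕ) : SuperRel
      (FreeAlgebra.ι ℚ (Sum.inr i) * FreeAlgebra.ι ℚ (Sum.inr j))
      (-(FreeAlgebra.ι ℚ (Sum.inr j) * FreeAlgebra.ι ℚ (Sum.inr i)))

/-- The algebra of polynomials in the noncommuting variables `x_i` and the anticommuting
variables `θ_i`. -/
abbrev SuperPoly : Type := RingQuot SuperRel

namespace SuperPoly

/-- The generators of `SuperPoly`. -/
def gen (v : ℕ ⊕ ℕ) : SuperPoly := RingQuot.mkAlgHom ℚ SuperRel (FreeAlgebra.ι ℚ v)

/-- The variable `x_i`. -/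
def x (i : ℕ) : SuperPoly := gen (Sum.inl i)

/-- The variable `θ_i`. -/
def θ (i : ℕ) : SuperPoly := gen (Sum.inr i)

lemma x_mul_θ (i j : ℕ) : x i * θ j = θ j * x i := by
  have := RingQuot.mkAlgHom_rel ℚ (SuperRel.comm i j)
  rwa [map_mul, map_mul] at this

lemma θ_mul_θ (i j : ℕ) : θ i * θ j = -(θ j * θ i) := by
  have := RingQuot.mkAlgHom_rel ℚ (SuperRel.anticomm i j)
  rwa [map_neg, map_mul, map_mul] at this

/-- The word `θ_{a_1} ⋯ θ_{a_m} x_{b_1} ⋯ x_{b_n}`. -/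
def word {n m : ℕ} (a : Fin m → ℕ) (b : Fin n → ℕ) : SuperPoly :=
  (List.ofFn fun i => θ (a i)).prod * (List.ofFn fun j => x (b j)).prod

/-- The truncation to the first `N` variables of each kind: it sets `x_i` and `θ_i` to zero for
all `i ≥ N`. -/
def trunc (N : ℕ) : SuperPoly →ₐ[ℚ] SuperPoly :=
  RingQuot.liftAlgHom ℚ
    ⟨FreeAlgebra.lift ℚ fun v => if Sum.elim id id v < N then gen v else 0, by
      intro p q h
      cases h with
      | comm i j =>
        have := x_mul_θ i j
        simp only [x, θ] at this
        by_cases hi : i < N <;> by_cases hj : j < N <;> simp [hi, hj, this]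
      | anticomm i j =>
        have := θ_mul_θ i j
        simp only [θ] at this
        by_cases hi : i < N <;> by_cases hj : j < N <;> simp [hi, hj]
        exact this⟩

lemma trunc_gen (N : ℕ) (v : ℕ ⊕ ℕ) :
    trunc N (gen v) = if Sum.elim id id v < N then gen v else 0 := by
  simp [trunc, gen]

lemma trunc_word_of_lt {n m : ℕ} (N : ℕ) (a : Fin m → ℕ) (b : Fin n → ℕ)
    (ha : ∀ i, a i < N) (hb : ∀ j, b j < N) : trunc N (word a b) = word a b := by
  have h1 : ∀ i, trunc N (θ (a i)) = θ (a i) := fun i => by simp [θ, trunc_gen, ha]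
  have h2 : ∀ j, trunc N (x (b j)) = x (b j) := fun j => by simp [x, trunc_gen, hb]
  simp [word, map_list_prod, List.map_ofFn, Function.comp_def, h1, h2]

lemma trunc_word_of_not_lt {n m : ℕ} (N : ℕ) (a : Fin m → ℕ) (b : Fin n → ℕ)
    (h : ¬ ((∀ i, a i < N) ∧ ∀ j, b j < N)) : trunc N (word a b) = 0 := by
  rw [word, map_mul, map_list_prod, map_list_prod, List.map_ofFn, List.map_ofFn]
  by_cases ha : ∀ i, a i < N
  · have hb : ¬ ∀ j, b j < N := fun hb => h ⟨ha, hb⟩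
    push Not at hb
    obtain ⟨j, hj⟩ := hb
    rw [List.prod_eq_zero (l := List.ofFn (trunc N ∘ fun j => x (b j))), mul_zero]
    exact (List.mem_ofFn).2 ⟨j, by simp [x, trunc_gen, not_lt.2 hj]⟩
  · push Not at ha
    obtain ⟨i, hi⟩ := ha
    rw [List.prod_eq_zero (l := List.ofFn (trunc N ∘ fun i => θ (a i))), zero_mul]
    exact (List.mem_ofFn).2 ⟨i, by simp [θ, trunc_gen, not_lt.2 hi]⟩

/-- The polynomials of total degree at most `d`. -/
def degreeLE (d : ℕ) : Submodule ℚ SuperPoly :=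
  (1 ⊔ Submodule.span ℚ (Set.range gen)) ^ d

lemma degreeLE_mono {d e : ℕ} (h : d ≤ e) : degreeLE d ≤ degreeLE e :=
  pow_le_pow_right' (show (1 : Submodule ℚ SuperPoly) ≤ _ from le_sup_left) h

lemma mul_mem_degreeLE {d e : ℕ} {p q : SuperPoly} (hp : p ∈ degreeLE d) (hq : q ∈ degreeLE e) :
    p * q ∈ degreeLE (d + e) := by
  rw [degreeLE, pow_add]
  exact Submodule.mul_mem_mul hp hq

lemma one_mem_degreeLE : (1 : SuperPoly) ∈ degreeLE 0 := by
  rw [degreeLE, pow_zero]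
  exact Submodule.one_le.1 le_rfl

lemma gen_mem_degreeLE (v : ℕ ⊕ ℕ) : gen v ∈ degreeLE 1 := by
  rw [degreeLE, pow_one]
  exact Submodule.mem_sup_right (Submodule.subset_span ⟨v, rfl⟩)

lemma prod_mem_degreeLE (l : List SuperPoly) (h : ∀ p ∈ l, p ∈ degreeLE 1) :
    l.prod ∈ degreeLE l.length := by
  induction l with
  | nil => simpa using one_mem_degreeLE
  | cons p l ih =>
    rw [List.prod_cons, List.length_cons, add_comm]
    exact mul_mem_degreeLE (h p (by simp)) (ih fun q hq => h q (by simp [hq]))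

lemma word_mem_degreeLE {n m : ℕ} (a : Fin m → ℕ) (b : Fin n → ℕ) :
    word a b ∈ degreeLE (m + n) := by
  refine mul_mem_degreeLE ?_ ?_
  · have := prod_mem_degreeLE (List.ofFn fun i => θ (a i)) (by
      intro p hp
      obtain ⟨i, rfl⟩ := (List.mem_ofFn).1 hp
      exact gen_mem_degreeLE _)
    simpa using this
  · have := prod_mem_degreeLE (List.ofFn fun j => x (b j)) (by
      intro p hp
      obtain ⟨i, rfl⟩ := (List.mem_ofFn).1 hp
      exact gen_mem_degreeLE _)
    simpa using this

end SuperPoly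

open SuperPoly

/-- The algebra of functions in noncommuting variables in superspace, that is, of formal power
series of bounded degree in the variables `x_i` and `θ_i`. A series `f` is given by the sequence
of polynomials `f N` obtained from it by setting `x_i = θ_i = 0` for all `i ≥ N`. -/
def SuperSeries : Subalgebra ℚ (ℕ → SuperPoly) where
  carrier := {f | (∀ N M, N ≤ M → trunc N (f M) = f N) ∧ ∃ d, ∀ N, f N ∈ degreeLE d}
  mul_mem' := by
    rintro f g ⟨hf, d, hd⟩ ⟨hg, e, he⟩
    exact ⟨fun N M h => by simp [hf N M h, hg N M h],
      d + e, fun N => mul_mem_degreeLE (hd N) (he N)⟩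
  add_mem' := by
    rintro f g ⟨hf, d, hd⟩ ⟨hg, e, he⟩
    exact ⟨fun N M h => by simp [hf N M h, hg N M h],
      max d e, fun N => add_mem (degreeLE_mono (le_max_left _ _) (hd N))
        (degreeLE_mono (le_max_right _ _) (he N))⟩
  algebraMap_mem' := by
    intro r
    refine ⟨fun N M _ => by simp, 0, fun N => ?_⟩
    rw [Pi.algebraMap_apply, Algebra.algebraMap_eq_smul_one]
    exact Submodule.smul_mem _ _ one_mem_degreeLE

/-- The formal sum `∑ c(a, b) θ_{a_1} ⋯ θ_{a_m} x_{b_1} ⋯ x_{b_n}` over all index tuples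
`(a, b) = (a_1, …, a_m, b_1, …, b_n)`. -/
def formalSum {n m : ℕ} (c : (Fin m → ℕ) → (Fin n → ℕ) → ℚ) : SuperSeries :=
  ⟨fun N => ∑ a ∈ Fintype.piFinset fun _ : Fin m => Finset.range N,
      ∑ b ∈ Fintype.piFinset fun _ : Fin n => Finset.range N, c a b • word a b, by
    refine ⟨fun N M h => ?_, m + n, fun N => ?_⟩
    · have hsub : ∀ k : ℕ, (Fintype.piFinset fun _ : Fin k => Finset.range N) ⊆
          Fintype.piFinset fun _ : Fin k => Finset.range M := fun k =>
        Fintype.piFinset_subset _ _ fun _ => Finset.range_mono h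
      simp only [map_sum, map_smul]
      symm
      refine Finset.sum_subset_zero_on_sdiff (hsub m) ?_ ?_
      · intro a ha
        refine Finset.sum_eq_zero fun b _ => ?_
        rw [trunc_word_of_not_lt, smul_zero]
        intro h'
        exact (Finset.mem_sdiff.1 ha).2 (by simpa using h'.1)
      · intro a ha
        refine Finset.sum_subset_zero_on_sdiff (hsub n) ?_ ?_
        · intro b hb
          rw [trunc_word_of_not_lt, smul_zero]
          intro h'
          exact (Finset.mem_sdiff.1 hb).2 (by simpa using h'.2)
        · intro b hb
          rw [trunc_word_of_lt N a b (by simpa using ha) (by simpa using hb)]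
    · exact sum_mem fun a _ => sum_mem fun b _ =>
        Submodule.smul_mem _ _ (word_mem_degreeLE a b)⟩

variable {n m : ℕ}

open Classical in
/-- The monomial function `m_K`. -/
def monomialFn (K : PSC n m) : SuperSeries := formalSum fun a b => if K.IsM a b then 1 else 0

open Classical in
/-- The power sum function `p_K`. -/
def powerSumFn (K : PSC n m) : SuperSeries := formalSum fun a b => if K.IsP a b then 1 else 0

open Classical in
/-- The elementary function `e_K`. -/
def elementaryFn (K : PSC n m) : SuperSeries := formalSum fun a b => if K.IsE a b then 1 else 0

open Classical in
/-- The complete homogeneous function `h_K`: the sum of `c_u u` over the monomials `u` that are not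
null-symmetric, where `c_u = (K ⊓ L)!` for the unique `L` with `u ∈ M(L)`. -/
def completeFn (K : PSC n m) : SuperSeries :=
  formalSum fun a b =>
    if h : PSC.NonNullSymmetric a b then ((K ⊓ PSC.shape h).blockFactorial : ℚ) else 0

/-- The Möbius function of the poset of partial set supercompositions of bidegree `(n, m)`, ordered
by strong coarsening, with rational values. -/
def μ (K L : PSC n m) : ℚ := IncidenceAlgebra.mu ℚ K L

end SuperNC

end

/-! Words with a repeated `θ` vanish, and any other word `u` lies in `M(N)` for exactly one `N`.
Reading off the coefficient of `u` expands everything in monomial functions: `m_N` has coefficient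
`[K ≤ N]` in `p_K`, `[K ⊓ N = ⊥]` in `e_K` and `(K ⊓ N)!` in `h_K`. The last case needs care because
`h_K` omits null-symmetric words; but if two fermionic blocks of `N` equal `{0}`, swapping the
corresponding `θ`s shows `m_N = -m_N`, so `m_N = 0`.

The first identity is Möbius inversion of `p_K = ∑_{N ≥ K} m_N`. The other two follow from it
termwise, once `∑_{K ≤ L} μ(K,L) e_K = μ(⊥,L) p_L` and `∑_{K ≤ L} μ(K,L) h_K = |μ(⊥,L)| p_L` are
known. Comparing coefficients of `m_N`, both are instances of one fact about meet semilattices,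
`IncidenceAlgebra.sum_mu_mul_sum_le_inf`: if `g z = ∑_{y ≤ z} f y`, then `∑_{K ≤ L} μ(K,L) g (K ⊓
N)` is `f L` when `L ≤ N` and `0` otherwise.

The functions `f` come from permutations of `Fin m ⊕ Fin n`, where each fermionic block has its own
copy of `0`. Those preserving the blocks of `K` number `K!`, and their signs sum to `[K = ⊥]`.
Sorting them by orbits writes both totals as sums over `L ≤ K`. Hence `μ(⊥,L)` is the signed count
of permutations whose orbits are the blocks of `L`. All of these have the same sign, so `|μ(⊥,L)|`
is their number, which is positive. -/

/-! ### Permutations, their orbits and their signs -/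

/-- Permutations with the same orbits have the same sign. -/
theorem Equiv.Perm.sign_eq_of_sameCycle_iff {α : Type*} [Fintype α] [DecidableEq α]
    {σ τ : Equiv.Perm α}
    (h : ∀ x y, σ.SameCycle x y ↔ τ.SameCycle x y) : σ.sign = τ.sign := by
  classical
  have hfix : ∀ (σ : Equiv.Perm α) x, σ x = x ↔ ∀ y, σ.SameCycle x y → x = y := by
    refine fun σ x => ⟨fun hx y ⟨i, hi⟩ => ?_, fun hx => (hx _ ⟨1, by simp⟩).symm⟩
    rw [← hi, Equiv.Perm.zpow_apply_eq_self_of_apply_eq_self hx]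
  have hsupp : σ.support = τ.support := by
    ext x
    simp only [Equiv.Perm.mem_support, ne_eq, hfix, h]
  -- The supports of the cycle factors are the nontrivial orbits, so this set depends only on the
  -- orbit relation. An orbit `s` contributes the sign `-(-1) ^ s.card`.
  have hset : ∀ σ : Equiv.Perm α, σ.cycleFactorsFinset.image Equiv.Perm.support =
      σ.support.image fun x => Finset.univ.filter (σ.SameCycle x) := by
    intro σ
    ext s
    simp only [Finset.mem_image]
    constructor
    · rintro ⟨c, hc, rfl⟩
      obtain ⟨x, hx⟩ := (Equiv.Perm.mem_cycleFactorsFinset_iff.1 hc).1.nonempty_support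
      refine ⟨x, Equiv.Perm.mem_cycleFactorsFinset_support_le hc hx, ?_⟩
      rw [Equiv.Perm.cycle_is_cycleOf hx hc]
      ext y
      simp [Equiv.Perm.mem_support_cycleOf_iff' (Equiv.Perm.mem_support.1
        (Equiv.Perm.mem_cycleFactorsFinset_support_le hc hx))]
    · rintro ⟨x, hx, rfl⟩
      refine ⟨σ.cycleOf x, Equiv.Perm.cycleOf_mem_cycleFactorsFinset_iff.2 hx, ?_⟩
      ext y
      simp [Equiv.Perm.mem_support_cycleOf_iff' (Equiv.Perm.mem_support.1 hx)]
  have hsign : ∀ σ : Equiv.Perm α, σ.sign =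
      ∏ s ∈ σ.support.image fun x => Finset.univ.filter (σ.SameCycle x), -(-1 : ℤˣ) ^ s.card := by
    intro σ
    rw [← hset, Finset.prod_image]
    · conv_lhs => rw [← σ.cycleFactorsFinset_noncommProd, Finset.map_noncommProd]
      rw [Finset.noncommProd_eq_prod]
      exact Finset.prod_congr rfl fun c hc =>
        (Equiv.Perm.mem_cycleFactorsFinset_iff.1 hc).1.sign
    -- Distinct cycle factors have disjoint nonempty supports, so no orbit is counted twice.
    · intro c hc d hd hcd
      by_contra hne
      have := (σ.cycleFactorsFinset_pairwise_disjoint hc hd hne).disjoint_support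
      rw [hcd, disjoint_self, Finset.bot_eq_empty, Equiv.Perm.support_eq_empty_iff] at this
      exact (Equiv.Perm.mem_cycleFactorsFinset_iff.1 hd).1.ne_one this
  rw [hsign, hsign, hsupp]
  simp only [h]

/-- Every equivalence relation on a finite type is the orbit relation of some permutation. -/
theorem Setoid.exists_perm_sameCycle_iff {α : Type*} [Finite α] (r : Setoid α) :
    ∃ σ : Equiv.Perm α, ∀ x y, σ.SameCycle x y ↔ r x y := by
  classical
  have := Fintype.ofFinite α
  let s : Quotient r → Finset α := fun q => Finset.univ.filter fun x => Quotient.mk r x = q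
  have hs : ∀ q x, x ∈ s q ↔ Quotient.mk r x = q := by simp [s]
  -- Each class `q` gets a permutation `f q` that is a single cycle on it; these are glued into `σ`
  -- by applying to `x` the permutation of its own class.
  choose f hf _ using fun q => (s q).exists_cycleOn
  have hmem : ∀ x, Quotient.mk r (f (Quotient.mk r x) x) = Quotient.mk r x := by
    intro x
    exact (hs _ _).1 ((hf _).1.1 ((hs _ _).2 rfl))
  have hinj : Function.Injective fun x => f (Quotient.mk r x) x := by
    intro x y hxy
    have hq : Quotient.mk r x = Quotient.mk r y := by
      rw [← hmem x, ← hmem y]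
      exact congrArg _ hxy
    simp only [hq] at hxy
    exact (f _).injective hxy
  let σ : Equiv.Perm α := Equiv.ofBijective _ (Finite.injective_iff_bijective.1 hinj)
  have hσ : ∀ x, σ x = f (Quotient.mk r x) x := fun x => rfl
  -- Iterating `σ` never leaves a class, so the same `f q` is applied at every step. The two claims
  -- need each other in the induction.
  have hpow : ∀ (k : ℕ) x, (σ ^ k) x = (f (Quotient.mk r x) ^ k) x ∧
      Quotient.mk r ((σ ^ k) x) = Quotient.mk r x := by
    intro k x
    induction k with
    | zero => simp
    | succ k ih =>
      rw [pow_succ', pow_succ', Equiv.Perm.mul_apply, Equiv.Perm.mul_apply, hσ, ih.2, ih.1]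
      refine ⟨rfl, ?_⟩
      rw [← ih.1]
      conv_lhs => rw [← ih.2]
      rw [hmem, ih.2]
  refine ⟨σ, fun x y => ⟨fun h => ?_, fun h => ?_⟩⟩
  · obtain ⟨k, _, hk⟩ := h.exists_pow_eq'
    exact Setoid.symm' _ (Quotient.exact (hk ▸ (hpow k x).2))
  · obtain ⟨k, _, hk⟩ := ((hf (Quotient.mk r x)).2 (x := x) (y := y) (by simp [hs])
      (by simpa [hs] using Quotient.sound (Setoid.symm' _ h))).exists_pow_eq'
    exact ⟨k, by rw [zpow_natCast, (hpow k x).1, hk]⟩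

/-- A function is constant on the orbits of a permutation if it is invariant under it. -/
theorem Equiv.Perm.SameCycle.apply_eq_of_comp_eq {α β : Type*} {σ : Equiv.Perm α} {f : α → β}
    (hf : f ∘ σ = f) {x y : α} (h : σ.SameCycle x y) : f x = f y := by
  obtain ⟨k, rfl⟩ := h
  have hf' : ∀ z, f (σ z) = f z := congrFun hf
  induction k with
  | zero => simp
  | succ k ih => rw [add_comm, zpow_add, zpow_one, Equiv.Perm.mul_apply, hf', ih]
  | pred k ih =>
    rw [ih, sub_eq_neg_add, zpow_add, Equiv.Perm.mul_apply, ← hf' ((σ ^ (-1 : ℤ)) _)]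
    simp

open scoped Classical in
/-- The signed number of permutations preserving the fibres of a noninjective function is zero. -/
theorem Equiv.Perm.sum_sign_comp_eq {α β : Type*} [Fintype α] [DecidableEq α] (f : α → β)
    [DecidablePred fun σ : Equiv.Perm α => f ∘ ⇑σ = f] :
    ∑ σ ∈ Finset.univ.filter fun σ : Equiv.Perm α => f ∘ ⇑σ = f, ((σ.sign : ℤ) : ℚ) =
      if Function.Injective f then 1 else 0 := by
  split_ifs with h
  · rw [Finset.sum_eq_single 1]
    · simp
    · intro σ hσ hne
      refine absurd (Equiv.ext fun x => h ?_) hne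
      exact congrFun (Finset.mem_filter.1 hσ).2 x
    · simp
  · simp only [Function.Injective, not_forall] at h
    obtain ⟨x, y, hxy, hne⟩ := h
    -- Since `f x = f y`, composing with this transposition preserves the condition, reverses the
    -- sign and has no fixed points.
    refine Finset.sum_involution (fun σ _ => σ * Equiv.swap x y) ?_ ?_ ?_ ?_
    · intro σ _
      simp [Equiv.Perm.sign_swap hne]
    · intro σ _ _ h
      exact hne (Equiv.swap_eq_one_iff.1 (mul_eq_left.1 h))
    · intro σ hσ
      simp only [Finset.mem_filter, Finset.mem_univ, true_and] at hσ ⊢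
      rw [Equiv.Perm.coe_mul, ← Function.comp_assoc, hσ]
      ext z
      simp only [Function.comp_apply, Equiv.swap_apply_def]
      split_ifs <;> simp_all
    · intro σ _
      simp [mul_assoc]

/-! ### Möbius inversion over a meet -/

/-- Möbius inversion in a finite meet semilattice for functions of the meet with a fixed element. -/
theorem IncidenceAlgebra.sum_mu_mul_sum_le_inf {α : Type*} [SemilatticeInf α] [Fintype α]
    [DecidableEq α] [LocallyFiniteOrder α] [DecidableLE α] (f g : α → ℚ)
    (hg : ∀ z, g z = ∑ y with y ≤ z, f y) (l x : α) :
    ∑ k with k ≤ l, IncidenceAlgebra.mu ℚ k l * g (k ⊓ x) = if l ≤ x then f l else 0 := by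
  have h1 : ∀ k, g (k ⊓ x) = ∑ y with y ≤ x, if y ≤ k then f y else 0 := by
    intro k
    rw [hg, ← Finset.sum_filter, Finset.filter_filter]
    simp only [le_inf_iff, and_comm]
  simp only [h1, Finset.mul_sum]
  rw [Finset.sum_comm]
  -- For fixed `y`, the remaining sum of `μ(k,l)` runs over the interval `[y,l]`, so it is `1` if `y
  -- = l` and `0` otherwise.
  have h2 : ∀ y, ∑ k with k ≤ l, IncidenceAlgebra.mu ℚ k l * (if y ≤ k then f y else 0) =
      if y = l then f l else 0 := by
    intro y
    have h := IncidenceAlgebra.sum_Icc_mu_left (𝕜 := ℚ) y l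
    have hI : Finset.Icc y l = (Finset.univ.filter (· ≤ l)).filter (y ≤ ·) := by
      ext; simp [and_comm]
    rw [hI] at h
    simp only [mul_ite, mul_zero]
    rw [← Finset.sum_filter, ← Finset.sum_mul, h, ite_mul, one_mul, zero_mul]
    split_ifs with e
    · rw [e]
    · rfl
  simp only [h2, Finset.sum_ite_eq', Finset.mem_filter, Finset.mem_univ, true_and]

/-! ### Supercompositions as equivalence relations -/

namespace SuperNC

namespace PSC

variable {n m : ℕ}

open scoped Classical in
/-- The block containing a given element, where `Sum.inl i` stands for the element `0` of the `i`th
fermionic block and `Sum.inr j` for `j ∈ [n]`. -/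
noncomputable def label (K : PSC n m) : Fin m ⊕ Fin n → Fin m ⊕ K.bos :=
  Sum.elim Sum.inl fun j =>
    if h : ∃ i, j.succ ∈ K.ferm i then Sum.inl h.choose
    else Sum.inr ⟨((K.cover j).resolve_left h).choose, ((K.cover j).resolve_left h).choose_spec.1⟩

lemma label_inl (K : PSC n m) (i : Fin m) : K.label (Sum.inl i) = Sum.inl i := rfl

lemma label_inr_eq_inl (K : PSC n m) (i : Fin m) (j : Fin n) :
    K.label (Sum.inr j) = Sum.inl i ↔ j.succ ∈ K.ferm i := by
  simp only [label, Sum.elim_inr]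
  split_ifs with h
  · rw [Sum.inl.injEq]
    exact ⟨fun e => e ▸ h.choose_spec, fun hi => K.ferm_eq_of_mem h.choose_spec hi⟩
  · simp only [false_iff]
    exact fun hi => h ⟨i, hi⟩

lemma label_inr_eq_inr (K : PSC n m) (B : K.bos) (j : Fin n) :
    K.label (Sum.inr j) = Sum.inr B ↔ j.succ ∈ (B : Finset (Fin (n + 1))) := by
  simp only [label, Sum.elim_inr]
  split_ifs with h
  · simp only [false_iff]
    exact K.notMem_bos_of_mem_ferm B.2 h.choose_spec
  · have hs := ((K.cover j).resolve_left h).choose_spec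
    rw [Sum.inr.injEq, Subtype.ext_iff]
    exact ⟨fun e => e ▸ hs.2, fun hB => K.bos_eq_of_mem hs.1 B.2 hs.2 hB⟩

/-- The equivalence relation of lying in the same block, where every fermionic block has its own
copy of the element `0`. -/
noncomputable def toSetoid (K : PSC n m) : Setoid (Fin m ⊕ Fin n) := Setoid.ker K.label

lemma toSetoid_inl_inl (K : PSC n m) (i i' : Fin m) :
    K.toSetoid (Sum.inl i) (Sum.inl i') ↔ i = i' := by
  rw [toSetoid, Setoid.ker_def]
  simp [label]

lemma toSetoid_inr_inl (K : PSC n m) (i : Fin m) (j : Fin n) :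
    K.toSetoid (Sum.inr j) (Sum.inl i) ↔ j.succ ∈ K.ferm i := by
  rw [toSetoid, Setoid.ker_def, ← label_inr_eq_inl]
  rfl

lemma toSetoid_inl_inr (K : PSC n m) (i : Fin m) (j : Fin n) :
    K.toSetoid (Sum.inl i) (Sum.inr j) ↔ j.succ ∈ K.ferm i := by
  rw [← toSetoid_inr_inl]
  exact ⟨Setoid.symm' _, Setoid.symm' _⟩

lemma toSetoid_inr_inr (K : PSC n m) (j k : Fin n) :
    K.toSetoid (Sum.inr j) (Sum.inr k) ↔ K.SameBlock j k := by
  rw [toSetoid, Setoid.ker_def]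
  constructor
  · intro h
    rcases hl : K.label (Sum.inr k) with i | B
    · exact Or.inl ⟨i, (label_inr_eq_inl ..).1 (h.trans hl), (label_inr_eq_inl ..).1 hl⟩
    · exact Or.inr ⟨B, B.2, (label_inr_eq_inr ..).1 (h.trans hl), (label_inr_eq_inr ..).1 hl⟩
  · rintro (⟨i, h1, h2⟩ | ⟨B, hB, h1, h2⟩)
    · rw [(label_inr_eq_inl K i j).2 h1, (label_inr_eq_inl K i k).2 h2]
    · rw [(label_inr_eq_inr K ⟨B, hB⟩ j).2 h1, (label_inr_eq_inr K ⟨B, hB⟩ k).2 h2]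

/-- Separate copies of `0` mark the fermionic blocks, so both clauses of the order become plain
refinement. -/
lemma toSetoid_le_iff (K L : PSC n m) : K.toSetoid ≤ L.toSetoid ↔ K ≤ L := by
  rw [le_iff]
  constructor
  · intro h
    refine ⟨fun i j hj => ?_, fun j k hjk => ?_⟩
    · exact (toSetoid_inr_inl ..).1 (h ((toSetoid_inr_inl ..).2 hj))
    · exact (toSetoid_inr_inr ..).1 (h ((toSetoid_inr_inr ..).2 hjk))
  · rintro ⟨h1, h2⟩ (i | j) (i' | k) h
    · exact (toSetoid_inl_inl ..).2 ((toSetoid_inl_inl ..).1 h)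
    · exact (toSetoid_inl_inr ..).2 (h1 _ _ ((toSetoid_inl_inr ..).1 h))
    · exact (toSetoid_inr_inl ..).2 (h1 _ _ ((toSetoid_inr_inl ..).1 h))
    · exact (toSetoid_inr_inr ..).2 (h2 _ _ ((toSetoid_inr_inr ..).1 h))

/-- An equivalence relation that does not identify different copies of `0` comes from a partial set
supercomposition. -/
lemma exists_toSetoid_eq (r : Setoid (Fin m ⊕ Fin n))
    (hr : ∀ i i', r (Sum.inl i) (Sum.inl i') → i = i') : ∃ K : PSC n m, K.toSetoid = r := by
  have hE : Equivalence fun j k : Fin n => r (Sum.inr j) (Sum.inr k) :=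
    ⟨fun _ => r.refl' _, r.symm', r.trans'⟩
  obtain ⟨K, hf, hs⟩ : ∃ K : PSC n m, (∀ i (j : Fin n), j.succ ∈ K.ferm i ↔
      r (Sum.inr j) (Sum.inl i)) ∧ ∀ j k, K.SameBlock j k ↔ r (Sum.inr j) (Sum.inr k) :=
    ⟨ofRel (fun i j => r (Sum.inr j) (Sum.inl i)) (fun j k => r (Sum.inr j) (Sum.inr k)) hE
      (fun i i' _ h h' => hr i i' (r.trans' (r.symm' h) h'))
      (fun _ _ _ h h' => r.trans' (r.symm' h) h'), fun i j => mem_ferm_ofRel i j,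
      fun j k => sameBlock_ofRel (f := fun i j => r (Sum.inr j) (Sum.inl i))
        (r := fun j k => r (Sum.inr j) (Sum.inr k))
        (fun _ _ _ h h' => r.trans' h (r.symm' h')) j k⟩
  refine ⟨K, Setoid.ext ?_⟩
  rintro (i | j) (i' | k)
  · rw [toSetoid_inl_inl]
    exact ⟨fun h => h ▸ r.refl' _, hr i i'⟩
  · rw [toSetoid_inl_inr, hf]
    exact ⟨r.symm', r.symm'⟩
  · rw [toSetoid_inr_inl, hf]
  · rw [toSetoid_inr_inr, hs]

open scoped Classical in
/-- The number of permutations that preserve the blocks of `K` is `K!`. -/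
lemma card_perm_label_comp_eq (K : PSC n m) :
    (Finset.univ.filter fun σ : Equiv.Perm (Fin m ⊕ Fin n) => K.label ∘ ⇑σ = K.label).card =
      K.blockFactorial := by
  rw [← Fintype.card_subtype, DomMulAct.stabilizer_card, Fintype.prod_sum_type, blockFactorial]
  congr 1
  · refine Finset.prod_congr rfl fun i _ => ?_
    congr 1
    rw [Fintype.card_subtype]
    -- The fibre of `label` over a fermionic block contains exactly one copy of `0`; this is why `0`
    -- counts in `K!`.
    refine Finset.card_bij (fun x _ => Sum.elim (fun _ => 0) Fin.succ x) ?_ ?_ ?_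
    · rintro (i' | j) h
      · exact K.zero_mem_ferm i
      · exact (label_inr_eq_inl ..).1 (Finset.mem_filter.1 h).2
    · rintro (i' | j) h (i'' | k) h' e
      · have h1 := (Finset.mem_filter.1 h).2
        have h2 := (Finset.mem_filter.1 h').2
        simp only [label, Sum.elim_inl, Sum.inl.injEq] at h1 h2
        rw [h1, h2]
      · exact absurd e.symm (Fin.succ_ne_zero k)
      · exact absurd e (Fin.succ_ne_zero j)
      · exact congrArg _ (Fin.succ_injective _ e)
    · refine fun y => Fin.cases (fun _ => ⟨Sum.inl i, by simp [label_inl], rfl⟩) (fun j hj => ?_) y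
      exact ⟨Sum.inr j, by simpa [label_inr_eq_inl] using hj, rfl⟩
  · rw [← Finset.prod_coe_sort K.bos]
    refine Finset.prod_congr rfl fun B _ => ?_
    congr 1
    rw [Fintype.card_subtype]
    refine Finset.card_bij (fun x _ => Sum.elim (fun _ => 0) Fin.succ x) ?_ ?_ ?_
    · rintro (i' | j) h
      · simp [label_inl] at h
      · exact (label_inr_eq_inr ..).1 (Finset.mem_filter.1 h).2
    · rintro (i' | j) h (i'' | k) h' e
      · simp [label_inl] at h
      · simp [label_inl] at h
      · simp [label_inl] at h'
      · exact congrArg _ (Fin.succ_injective _ e)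
    · refine fun y => Fin.cases (fun h => absurd h (K.zero_notMem_bos _ B.2)) (fun j hj => ?_) y
      exact ⟨Sum.inr j, by simpa [label_inr_eq_inr] using hj, rfl⟩

lemma label_injective_iff (K : PSC n m) : Function.Injective K.label ↔ K = ⊥ := by
  have hbot : ∀ j k : Fin n, (⊥ : PSC n m).SameBlock j k → j = k := by
    rintro j k (⟨i, h, _⟩ | ⟨B, hB, h1, h2⟩)
    · exact absurd (Finset.mem_singleton.1 h) (Fin.succ_ne_zero j)
    · obtain ⟨l, _, rfl⟩ := Finset.mem_image.1 hB
      exact Fin.succ_injective _ ((Finset.mem_singleton.1 h1).trans (Finset.mem_singleton.1 h2).symm)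
  have hbot' : ∀ i (j : Fin n), j.succ ∉ (⊥ : PSC n m).ferm i :=
    fun i j h => Fin.succ_ne_zero j (Finset.mem_singleton.1 h)
  rw [Setoid.injective_iff_ker_bot, ← toSetoid]
  constructor
  · intro h
    rw [eq_bot_iff, ← toSetoid_le_iff, h]
    exact bot_le
  · rintro rfl
    rw [eq_bot_iff]
    rintro (i | j) (i' | k) h
    · exact congrArg _ ((toSetoid_inl_inl ..).1 h)
    · exact absurd ((toSetoid_inl_inr ..).1 h) (hbot' _ _)
    · exact absurd ((toSetoid_inr_inl ..).1 h) (hbot' _ _)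
    · exact congrArg _ (hbot _ _ ((toSetoid_inr_inr ..).1 h))

/-! ### Permutations with prescribed orbits and the values `μ(⊥,K)` -/

open scoped Classical in
/-- The permutations whose orbits are the blocks of `K`. -/
noncomputable def cyclePerms (K : PSC n m) : Finset (Equiv.Perm (Fin m ⊕ Fin n)) :=
  Finset.univ.filter fun σ => Equiv.Perm.SameCycle.setoid σ = K.toSetoid

lemma mem_cyclePerms {K : PSC n m} {σ : Equiv.Perm (Fin m ⊕ Fin n)} :
    σ ∈ K.cyclePerms ↔ Equiv.Perm.SameCycle.setoid σ = K.toSetoid := by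
  simp [cyclePerms]

lemma cyclePerms_nonempty (K : PSC n m) : K.cyclePerms.Nonempty := by
  obtain ⟨σ, hσ⟩ := K.toSetoid.exists_perm_sameCycle_iff
  exact ⟨σ, mem_cyclePerms.2 (Setoid.ext hσ)⟩

open scoped Classical in
/-- The permutations preserving the blocks of `K` are sorted by their orbits. -/
lemma sum_sum_cyclePerms (K : PSC n m) (f : Equiv.Perm (Fin m ⊕ Fin n) → ℚ) :
    ∑ L : PSC n m with L ≤ K, ∑ σ ∈ L.cyclePerms, f σ =
      ∑ σ ∈ Finset.univ.filter fun σ : Equiv.Perm (Fin m ⊕ Fin n) => K.label ∘ ⇑σ = K.label, f σ := by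
  rw [← Finset.sum_biUnion]
  · refine Finset.sum_congr (Finset.ext fun σ => ?_) fun _ _ => rfl
    simp only [Finset.mem_biUnion, Finset.mem_filter, Finset.mem_univ, true_and, mem_cyclePerms]
    constructor
    · rintro ⟨L, hL, hσ⟩
      ext1 x
      refine (toSetoid_le_iff L K).2 hL (?_ : L.toSetoid (σ x) x)
      rw [← hσ]
      exact ⟨-1, by simp⟩
    · intro hσ
      have hle : Equiv.Perm.SameCycle.setoid σ ≤ K.toSetoid :=
        fun x y h => Equiv.Perm.SameCycle.apply_eq_of_comp_eq hσ h
      -- The orbit relation refines that of `K`, so it too keeps the copies of `0` apart and comes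
      -- from some `L`.
      obtain ⟨L, hL⟩ := exists_toSetoid_eq (Equiv.Perm.SameCycle.setoid σ)
        fun i i' h => (toSetoid_inl_inl K i i').1 (hle h)
      exact ⟨L, (toSetoid_le_iff L K).1 (hL ▸ hle), hL.symm⟩
  · intro L _ L' _ hne
    refine Finset.disjoint_left.2 fun σ h h' => hne ?_
    have := (mem_cyclePerms.1 h).symm.trans (mem_cyclePerms.1 h')
    exact le_antisymm ((toSetoid_le_iff ..).1 this.le) ((toSetoid_le_iff ..).1 this.ge)

open scoped Classical in
lemma sum_card_cyclePerms (K : PSC n m) :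
    ∑ L : PSC n m with L ≤ K, (L.cyclePerms.card : ℚ) = K.blockFactorial := by
  have h := K.sum_sum_cyclePerms fun _ => 1
  simp only [Finset.sum_const, nsmul_eq_mul, mul_one] at h
  rw [h, card_perm_label_comp_eq]

open scoped Classical in
lemma sum_sign_cyclePerms (K : PSC n m) :
    ∑ L : PSC n m with L ≤ K, ∑ σ ∈ L.cyclePerms, ((σ.sign : ℤ) : ℚ) = if K = ⊥ then 1 else 0 := by
  rw [sum_sum_cyclePerms, Equiv.Perm.sum_sign_comp_eq]
  simp only [label_injective_iff]

/-- The value of the Möbius function `μ(0̂, K)` as a signed number of permutations. -/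
lemma mu_bot (K : PSC n m) : μ ⊥ K = ∑ σ ∈ K.cyclePerms, ((σ.sign : ℤ) : ℚ) := by
  classical
  -- With both fixed elements equal to `K`, every meet is the summation variable itself, and only
  -- `⊥` contributes.
  have h := IncidenceAlgebra.sum_mu_mul_sum_le_inf
    (fun L : PSC n m => ∑ σ ∈ L.cyclePerms, ((σ.sign : ℤ) : ℚ)) (fun L => if L = ⊥ then 1 else 0)
    (fun L => by convert (sum_sign_cyclePerms L).symm) K K
  rw [if_pos le_rfl] at h
  rw [← h, Finset.sum_eq_single ⊥]
  · rw [bot_inf_eq, if_pos rfl, mul_one]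
    rfl
  · intro L hL hne
    rw [inf_eq_left.2 (Finset.mem_filter.1 hL).2, if_neg hne, mul_zero]
  · simp

/-- There is no cancellation in `mu_bot`, since the orbits determine the sign. -/
lemma abs_mu_bot (K : PSC n m) : |μ ⊥ K| = K.cyclePerms.card := by
  obtain ⟨τ, hτ⟩ := K.cyclePerms_nonempty
  have h : ∀ σ ∈ K.cyclePerms, ((Equiv.Perm.sign σ : ℤ) : ℚ) = ((Equiv.Perm.sign τ : ℤ) : ℚ) := by
    intro σ hσ
    have := Equiv.Perm.sign_eq_of_sameCycle_iff (σ := σ) (τ := τ) fun x y => ?_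
    · rw [this]
    · exact Setoid.ext_iff.1 ((mem_cyclePerms.1 hσ).trans (mem_cyclePerms.1 hτ).symm) x y
  rw [mu_bot, Finset.sum_congr rfl h, Finset.sum_const, nsmul_eq_mul, abs_mul, Nat.abs_cast,
    ← Int.cast_abs, Int.abs_eq_natAbs, Int.units_natAbs]
  simp

lemma mu_bot_ne_zero (K : PSC n m) : μ ⊥ K ≠ 0 := by
  rw [← abs_pos, abs_mu_bot, Nat.cast_pos]
  exact K.cyclePerms_nonempty.card_pos

open scoped Classical in
lemma sum_mu_mul_blockFactorial_inf (L N : PSC n m) :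
    ∑ K : PSC n m with K ≤ L, μ K L * ((K ⊓ N).blockFactorial : ℚ) =
      if L ≤ N then |μ ⊥ L| else 0 := by
  rw [abs_mu_bot]
  unfold μ
  convert IncidenceAlgebra.sum_mu_mul_sum_le_inf (fun L : PSC n m => (L.cyclePerms.card : ℚ))
    (fun L => (L.blockFactorial : ℚ)) (fun L => (sum_card_cyclePerms L).symm) L N

open scoped Classical in
lemma sum_mu_mul_inf_eq_bot (L N : PSC n m) :
    ∑ K : PSC n m with K ≤ L, μ K L * (if K ⊓ N = ⊥ then 1 else 0) =
      if L ≤ N then μ ⊥ L else 0 := by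
  rw [mu_bot]
  unfold μ
  convert IncidenceAlgebra.sum_mu_mul_sum_le_inf
    (fun L : PSC n m => ∑ σ ∈ L.cyclePerms, ((σ.sign : ℤ) : ℚ)) (fun L => if L = ⊥ then 1 else 0)
    (fun L => (sum_sign_cyclePerms L).symm) L N

end PSC

/-! ### Antisymmetry of words in the `θ` variables -/

namespace SuperPoly

instance : IsAddTorsionFree SuperPoly := .of_module_rat _

/-- The linear map sending the `i`th basis vector to `θ_i`. -/
noncomputable def θLin : (ℕ →₀ ℚ) →ₗ[ℚ] SuperPoly := Finsupp.linearCombination ℚ θ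

/-- Anticommutation on basis vectors extends bilinearly and gives `v² = -v²`. This is the condition
for `θLin` to extend to the exterior algebra. -/
lemma θLin_mul_self (v : ℕ →₀ ℚ) : θLin v * θLin v = 0 := by
  have h : (LinearMap.mul ℚ SuperPoly).compl₁₂ θLin θLin +
      ((LinearMap.mul ℚ SuperPoly).compl₁₂ θLin θLin).flip = 0 := by
    ext i j
    simp [θLin, θ_mul_θ i j]
  have h' := LinearMap.congr_fun₂ h v v
  simp only [LinearMap.add_apply, LinearMap.flip_apply, LinearMap.compl₁₂_apply,
    LinearMap.mul_apply', LinearMap.zero_apply] at h'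
  exact self_eq_neg.1 (eq_neg_of_add_eq_zero_left h')

/-- The product of the `θ_{a_i}` as an alternating map. -/
noncomputable def θAlt (m : ℕ) : (ℕ →₀ ℚ) [⋀^Fin m]→ₗ[ℚ] SuperPoly :=
  (ExteriorAlgebra.lift ℚ ⟨θLin, θLin_mul_self⟩).toLinearMap.compAlternatingMap
    (ExteriorAlgebra.ιMulti ℚ m)

lemma word_eq_θAlt {n m : ℕ} (a : Fin m → ℕ) (b : Fin n → ℕ) :
    word a b = θAlt m (fun i => Finsupp.single (a i) 1) * (List.ofFn fun j => x (b j)).prod := by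
  simp [word, θAlt, θLin, ExteriorAlgebra.ιMulti_apply, map_list_prod, List.map_ofFn,
    Function.comp_def]

lemma word_eq_zero {n m : ℕ} {a : Fin m → ℕ} (b : Fin n → ℕ) (ha : ¬ Function.Injective a) :
    word a b = 0 := by
  rw [word_eq_θAlt, AlternatingMap.map_eq_zero_of_not_injective, zero_mul]
  exact fun h => ha fun i j hij => h (by simp only [hij])

lemma word_comp_swap {n m : ℕ} (a : Fin m → ℕ) (b : Fin n → ℕ) {i i' : Fin m} (h : i ≠ i') :
    word (a ∘ Equiv.swap i i') b = -word a b := by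
  refine eq_neg_of_add_eq_zero_left ?_
  rw [word_eq_θAlt, word_eq_θAlt, ← add_mul]
  exact (congrArg (· * _)
    ((θAlt m).map_swap_add (fun i => Finsupp.single (a i) 1) h)).trans (zero_mul _)

end SuperPoly

/-! ### Formal sums and vanishing monomial functions -/

open SuperPoly

variable {n m : ℕ}

lemma formalSum_congr {c d : (Fin m → ℕ) → (Fin n → ℕ) → ℚ}
    (h : ∀ a b, Function.Injective a → c a b = d a b) : formalSum c = formalSum d := by
  refine Subtype.ext (funext fun N => Finset.sum_congr rfl fun a _ =>
    Finset.sum_congr rfl fun b _ => ?_)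
  by_cases ha : Function.Injective a
  · rw [h a b ha]
  · rw [word_eq_zero b ha, smul_zero, smul_zero]

lemma formalSum_apply (c : (Fin m → ℕ) → (Fin n → ℕ) → ℚ) (N : ℕ) :
    (formalSum c : ℕ → SuperPoly) N = ∑ a ∈ Fintype.piFinset fun _ : Fin m => Finset.range N,
      ∑ b ∈ Fintype.piFinset fun _ : Fin n => Finset.range N, c a b • word a b := rfl

lemma sum_smul_formalSum {ι : Type*} (s : Finset ι) (r : ι → ℚ)
    (c : ι → (Fin m → ℕ) → (Fin n → ℕ) → ℚ) :
    ∑ k ∈ s, r k • formalSum (c k) = formalSum fun a b => ∑ k ∈ s, r k * c k a b := by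
  refine Subtype.ext (funext fun N => ?_)
  simp only [AddSubmonoidClass.coe_finsetSum, Finset.sum_apply, SetLike.val_smul, Pi.smul_apply,
    formalSum_apply, Finset.smul_sum, Finset.sum_smul, mul_smul]
  rw [Finset.sum_comm]
  exact Finset.sum_congr rfl fun a _ => Finset.sum_comm

/-- Reindexing by the swap negates every word and keeps its coefficient, so each truncation equals
its own negative. -/
lemma formalSum_eq_zero {c : (Fin m → ℕ) → (Fin n → ℕ) → ℚ} {i i' : Fin m} (hi : i ≠ i')
    (h : ∀ a b, c (a ∘ Equiv.swap i i') b = c a b) : formalSum c = 0 := by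
  refine Subtype.ext (funext fun N => ?_)
  rw [formalSum_apply]
  refine self_eq_neg.1 ?_
  rw [← Finset.sum_neg_distrib]
  refine Finset.sum_bij' (fun a _ => a ∘ Equiv.swap i i') (fun a _ => a ∘ Equiv.swap i i')
    ?_ ?_ ?_ ?_ ?_
  · exact fun a ha => Fintype.mem_piFinset.2 fun k => Fintype.mem_piFinset.1 ha _
  · exact fun a ha => Fintype.mem_piFinset.2 fun k => Fintype.mem_piFinset.1 ha _
  · exact fun a _ => funext fun k => by simp
  · exact fun a _ => funext fun k => by simp
  · intro a _
    simp only [h, word_comp_swap a _ hi, smul_neg, Finset.sum_neg_distrib, neg_neg]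

lemma monomialFn_eq_zero {K : PSC n m} {i i' : Fin m} (hne : i ≠ i')
    (hi : ∀ j : Fin n, j.succ ∉ K.ferm i) (hi' : ∀ j : Fin n, j.succ ∉ K.ferm i') :
    monomialFn K = 0 := by
  have key : ∀ a b, K.IsM a b → K.IsM (a ∘ Equiv.swap i i') b := by
    refine fun a b h => ⟨fun k j => ?_, h.2⟩
    rw [Function.comp_apply, h.1]
    rw [Equiv.swap_apply_def]
    split_ifs with h1 h2
    · rw [h1]; exact iff_of_false (hi' j) (hi j)
    · rw [h2]; exact iff_of_false (hi j) (hi' j)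
    · rfl
  rw [monomialFn]
  refine formalSum_eq_zero hne fun a b => ?_
  have : K.IsM (a ∘ Equiv.swap i i') b ↔ K.IsM a b := by
    refine ⟨fun h => ?_, key a b⟩
    have := key _ _ h
    rwa [Function.comp_assoc, ← Equiv.Perm.coe_mul, Equiv.swap_mul_self] at this
  split_ifs <;> tauto

/-! ### Coefficients of a word in terms of its shape -/

namespace PSC

/-- Every word with distinct `a_i` belongs to a set `M(L)`. -/
lemma exists_isM {a : Fin m → ℕ} (b : Fin n → ℕ) (ha : Function.Injective a) :
    ∃ L : PSC n m, L.IsM a b :=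
  ⟨ofRel (fun i j => a i = b j) (fun j k => b j = b k)
      ⟨fun _ => rfl, fun h => h.symm, fun h h' => h.trans h'⟩
      (fun _ _ _ h1 h2 => ha (h1.trans h2.symm)) (fun _ _ _ h1 h2 => h2.trans h1),
    fun i j => (mem_ferm_ofRel (f := fun i j => a i = b j) i j).symm,
    fun j k => (sameBlock_ofRel (f := fun i j => a i = b j) (r := fun j k => b j = b k)
      (fun _ _ _ h1 h2 => h1.symm.trans h2) j k).symm⟩

lemma IsM.isP_iff {K L : PSC n m} {a : Fin m → ℕ} {b : Fin n → ℕ} (hL : L.IsM a b) :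
    K.IsP a b ↔ K ≤ L := by
  rw [le_iff, IsP]
  simp only [hL.1, hL.2]

/-- The coincidences among the indices are exactly the incidences of `L`; membership in `E(K)`
forbids any nontrivial one shared with `K`. -/
lemma IsM.isE_iff {K L : PSC n m} {a : Fin m → ℕ} {b : Fin n → ℕ} (hL : L.IsM a b) :
    K.IsE a b ↔ K ⊓ L = ⊥ := by
  rw [eq_bot_iff, le_iff, IsE]
  have hbf : ∀ i (j : Fin n), j.succ ∉ (⊥ : PSC n m).ferm i :=
    fun i j h => Fin.succ_ne_zero j (Finset.mem_singleton.1 h)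
  have hbs : ∀ j k : Fin n, (⊥ : PSC n m).SameBlock j k ↔ j = k := by
    refine fun j k => ⟨?_, fun h => h ▸ SameBlock.refl _ j⟩
    rintro (⟨i, h, _⟩ | ⟨B, hB, h1, h2⟩)
    · exact absurd h (hbf i j)
    · obtain ⟨l, _, rfl⟩ := Finset.mem_image.1 hB
      exact Fin.succ_injective _
        ((Finset.mem_singleton.1 h1).trans (Finset.mem_singleton.1 h2).symm)
  have hf : ∀ i (j : Fin n), j.succ ∈ (K ⊓ L).ferm i ↔ j.succ ∈ K.ferm i ∧ j.succ ∈ L.ferm i :=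
    mem_ferm_meet K L
  have hs : ∀ j k, (K ⊓ L).SameBlock j k ↔ K.SameBlock j k ∧ L.SameBlock j k := sameBlock_meet K L
  simp only [hf, hs, hbf, hbs, ne_eq, hL.1, hL.2, and_imp, imp_false]
  refine and_congr (forall₂_congr fun i j => not_and.symm) (forall₂_congr fun j k => ?_)
  tauto

open scoped Classical in
lemma IsM.sum_ite {L : PSC n m} {a : Fin m → ℕ} {b : Fin n → ℕ} (hL : L.IsM a b)
    (s : Finset (PSC n m)) (r : PSC n m → ℚ) :
    ∑ N ∈ s, r N * (if N.IsM a b then 1 else 0) = if L ∈ s then r L else 0 := by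
  rw [← Finset.sum_ite_eq' s L r]
  refine Finset.sum_congr rfl fun N _ => ?_
  have : N.IsM a b ↔ N = L := ⟨fun h => h.unique hL, fun h => h ▸ hL⟩
  simp only [this, mul_ite, mul_one, mul_zero]

end PSC

/-! ### Expansions in monomial functions -/

open scoped Classical in
lemma powerSumFn_eq_sum (K : PSC n m) :
    powerSumFn K = ∑ N : PSC n m, (if K ≤ N then (1 : ℚ) else 0) • monomialFn N := by
  simp only [monomialFn]
  rw [sum_smul_formalSum]
  refine formalSum_congr fun a b ha => ?_
  obtain ⟨L, hL⟩ := PSC.exists_isM b ha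
  rw [hL.sum_ite, if_pos (Finset.mem_univ L)]
  simp only [hL.isP_iff]

open scoped Classical in
lemma elementaryFn_eq_sum (K : PSC n m) :
    elementaryFn K = ∑ N : PSC n m, (if K ⊓ N = ⊥ then (1 : ℚ) else 0) • monomialFn N := by
  simp only [monomialFn]
  rw [sum_smul_formalSum]
  refine formalSum_congr fun a b ha => ?_
  obtain ⟨L, hL⟩ := PSC.exists_isM b ha
  rw [hL.sum_ite, if_pos (Finset.mem_univ L)]
  simp only [hL.isE_iff]

open scoped Classical in
lemma completeFn_eq_sum (K : PSC n m) :
    completeFn K = ∑ N : PSC n m, ((K ⊓ N).blockFactorial : ℚ) • monomialFn N := by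
  -- `S` consists of the shapes with at most one fermionic block equal to `{0}`. Among words with
  -- distinct `a_i`, these are the shapes of those that are not null-symmetric; outside `S` the
  -- monomial function is zero.
  let S : Finset (PSC n m) := Finset.univ.filter fun N =>
    ∀ i i', (∀ j : Fin n, j.succ ∉ N.ferm i) → (∀ j : Fin n, j.succ ∉ N.ferm i') → i = i'
  rw [← Finset.sum_subset (Finset.subset_univ S)]
  · simp only [monomialFn]
    rw [sum_smul_formalSum]
    refine formalSum_congr fun a b ha => ?_
    obtain ⟨L, hL⟩ := PSC.exists_isM b ha
    rw [hL.sum_ite]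
    have hiff : PSC.NonNullSymmetric a b ↔ L ∈ S := by
      simp only [S, Finset.mem_filter, Finset.mem_univ, true_and, ← hL.1]
      constructor
      · intro h i i' hi hi'
        refine ha (h.2 ⟨⟨i, rfl⟩, ?_⟩ ⟨⟨i', rfl⟩, ?_⟩)
        · rintro ⟨j, hj⟩
          exact hi j hj.symm
        · rintro ⟨j, hj⟩
          exact hi' j hj.symm
      · refine fun h => ⟨ha, ?_⟩
        rintro _ ⟨⟨i, rfl⟩, hi⟩ _ ⟨⟨i', rfl⟩, hi'⟩
        rw [h i i' (fun j hj => hi ⟨j, hj.symm⟩) (fun j hj => hi' ⟨j, hj.symm⟩)]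
    by_cases h : PSC.NonNullSymmetric a b
    · rw [dif_pos h, if_pos (hiff.1 h), (PSC.shape_spec h).unique hL]
    · rw [dif_neg h, if_neg (fun h' => h (hiff.2 h'))]
  · intro N _ hN
    simp only [S, Finset.mem_filter, Finset.mem_univ, true_and, not_forall] at hN
    obtain ⟨i, i', hi, hi', hne⟩ := hN
    rw [monomialFn_eq_zero hne hi hi', smul_zero]

/-! ### Inversion formulas -/

open scoped Classical in
/-- Möbius inversion of the expansion of the power sums in monomial functions. -/
lemma monomialFn_eq_sum_powerSumFn (I : PSC n m) :
    monomialFn I = ∑ K : PSC n m with I ≤ K, μ I K • powerSumFn K := by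
  simp only [powerSumFn_eq_sum, Finset.smul_sum, smul_smul]
  rw [Finset.sum_comm]
  simp only [← Finset.sum_smul]
  have h : ∀ N : PSC n m, ∑ K : PSC n m with I ≤ K, μ I K * (if K ≤ N then (1 : ℚ) else 0) =
      if I = N then 1 else 0 := by
    intro N
    rw [← IncidenceAlgebra.sum_Icc_mu_right (𝕜 := ℚ) I N]
    simp only [mul_ite, mul_one, mul_zero]
    rw [← Finset.sum_filter, Finset.filter_filter]
    exact Finset.sum_congr (by ext; simp) fun _ _ => rfl
  simp only [h, ite_smul, one_smul, zero_smul, Finset.sum_ite_eq, Finset.mem_univ, if_true]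

open scoped Classical in
-- The coefficients of each `m_N` agree by `PSC.sum_mu_mul_inf_eq_bot`; this turns the inner sum of
-- the second identity into a multiple of a power sum.
lemma sum_mu_smul_elementaryFn (L : PSC n m) :
    ∑ K : PSC n m with K ≤ L, μ K L • elementaryFn K = μ ⊥ L • powerSumFn L := by
  simp only [elementaryFn_eq_sum, powerSumFn_eq_sum, Finset.smul_sum, smul_smul]
  rw [Finset.sum_comm]
  refine Finset.sum_congr rfl fun N _ => ?_
  rw [← Finset.sum_smul, mul_ite, mul_one, mul_zero, ← PSC.sum_mu_mul_inf_eq_bot]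

open scoped Classical in
lemma sum_mu_smul_completeFn (L : PSC n m) :
    ∑ K : PSC n m with K ≤ L, μ K L • completeFn K = |μ ⊥ L| • powerSumFn L := by
  simp only [completeFn_eq_sum, powerSumFn_eq_sum, Finset.smul_sum, smul_smul]
  rw [Finset.sum_comm]
  refine Finset.sum_congr rfl fun N _ => ?_
  rw [← Finset.sum_smul, mul_ite, mul_one, mul_zero, ← PSC.sum_mu_mul_blockFactorial_inf]

end SuperNC

open SuperNC in
open scoped Classical in
theorem mainTheorem3 (n m : ℕ) (I : PSC n m) (hI : I.IsSetSuperpartition) :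
    monomialFn I = ∑ K : PSC n m with I ≤ K, μ I K • powerSumFn K ∧
    monomialFn I = ∑ L : PSC n m with I ≤ L, (μ I L / μ ⊥ L) •
      ∑ K : PSC n m with K ≤ L, μ K L • elementaryFn K ∧
    monomialFn I = ∑ L : PSC n m with I ≤ L, (μ I L / |μ ⊥ L|) •
      ∑ K : PSC n m with K ≤ L, μ K L • completeFn K := by
  refine ⟨monomialFn_eq_sum_powerSumFn I, ?_, ?_⟩
  · rw [monomialFn_eq_sum_powerSumFn I]
    refine Finset.sum_congr rfl fun L _ => ?_
    -- The denominator cancels the factor `μ(⊥,L)` of the inner sum, leaving the term of the power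
    -- sum expansion.
    rw [sum_mu_smul_elementaryFn, smul_smul, div_mul_cancel₀ _ L.mu_bot_ne_zero]
  · rw [monomialFn_eq_sum_powerSumFn I]
    refine Finset.sum_congr rfl fun L _ => ?_
    rw [sum_mu_smul_completeFn, smul_smul, div_mul_cancel₀ _ (abs_ne_zero.2 L.mu_bot_ne_zero)]
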